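/- Let $n \ge 2$, let $S^{n-1} = \{x \in \mathbb{R}^n : x\cdot x = 1\}$ carry the surface measure $\omega$ induced by Lebesgue measure, and let $\mathcal{C}(S^{n-1})$ be the space of complex-valued continuous functions on $S^{n-1}$ with the inner product $(f,g) = \int_{S^{n-1}} f(x)\overline{g(x)}\,d\omega(x)$ and the norm $\|f\| = \sqrt{(f,f)}$. The orthogonal group $\mathrm{O}(\mathbb{R}^n)$ of linear isometries of $\mathbb{R}^n$ acts on $\mathcal{C}(S^{n-1})$ by $(uf)(x) = f(u^{-1}x)$. For $k = 0,1,2,\dots$ let $H_k \subseteq \mathcal{C}(S^{n-1})$ be the space of restrictions to $S^{n-1}$ of complex polynomials in $x_1,\dots,x_n$ that are homogeneous of degree $k$ (or zero) and are annihilated by the Laplace operator $\Delta = \frac{\partial^2}{\partial x_1^2} + \cdots + \frac{\partial^2}{\partial x_n^2}$. Then: 1. $\mathcal{C}(S^{n-1}) = H_0 \perp H_1 \perp H_2 \perp \cdots$, that is, $(f,g) = 0$ whenever $f \in H_k$, $g \in H_l$ and $k \ne l$, and for every $f \in \mathcal{C}(S^{n-1})$ there is exactly one sequence $(f_k)_{k\ge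 0}$ with $f_k \in H_k$ for all $k$ and $\lim_{N\to\infty}\bigl\|f - \sum_{k<N} f_k\bigr\| = 0$. 2. Every $H_k$ is $\mathrm{O}(\mathbb{R}^n)$-invariant and irreducible: it is nonzero, and $\{0\}$ and $H_k$ are its only $\mathrm{O}(\mathbb{R}^n)$-invariant subspaces. 3. The $H_k$ are pairwise inequivalent: for $k \ne l$ there is no bijective linear map $T : H_k \to H_l$ with $T(uf) = u\,T(f)$ for all $u \in \mathrm{O}(\mathbb{R}^n)$ and $f \in H_k$. 4. Every $H_k$ is finite-dimensional, of dimension $\binom{n+k-1}{n-1} - \binom{n+k-3}{n-1}$, where $\binom{m}{n-1} = 0$ for every integer $m < n-1$ (including $m = -1$). -/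

import Mathlib

open MeasureTheory

noncomputable section

namespace SphericalHarmonics

/-- The unit sphere `S^{n-1} = {x ∈ ℝⁿ : ‖x‖ = 1}` for the Euclidean norm. -/
abbrev Sph (n : ℕ) : Type := Metric.sphere (0 : EuclideanSpace ℝ (Fin n)) 1

/-- The orthogonal group `O(ℝⁿ)`: the linear isometries of Euclidean `n`-space. -/
abbrev OGroup (n : ℕ) : Type :=
  EuclideanSpace ℝ (Fin n) ≃ₗᵢ[ℝ] EuclideanSpace ℝ (Fin n)

/-- The surface area `ω` on `S^{n-1}` induced by Lebesgue measure on `ℝⁿ`. -/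
def surfaceMeasure (n : ℕ) : Measure (Sph n) :=
  (volume : Measure (EuclideanSpace ℝ (Fin n))).toSphere

/-- The inner product `(f, g) = ∫ f(x) conj(g(x)) dω(x)` on `C(S^{n-1})`. -/
def sphInner {n : ℕ} (f g : C(Sph n, ℂ)) : ℂ :=
  ∫ x, f x * (starRingEnd ℂ) (g x) ∂(surfaceMeasure n)

/-- The norm `‖f‖ = √(f, f)` of convergence in the mean (not the supremum norm). -/
def meanNorm {n : ℕ} (f : C(Sph n, ℂ)) : ℝ :=
  Real.sqrt (sphInner f f).re

/-- The continuous map `S^{n-1} → S^{n-1}` given by an orthogonal transformation. -/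
def actSphere {n : ℕ} (u : OGroup n) : C(Sph n, Sph n) where
  toFun x := ⟨u x.1, by simp⟩
  continuous_toFun := by fun_prop

/-- The linear action `(u f)(x) = f(u⁻¹ x)` of `O(ℝⁿ)` on `C(S^{n-1})`. -/
def sphRep (n : ℕ) : Representation ℂ (OGroup n) C(Sph n, ℂ) where
  toFun u :=
    { toFun := fun f => f.comp (actSphere u⁻¹)
      map_add' := fun _ _ => rfl
      map_smul' := fun _ _ => rfl }
  map_one' := rfl
  map_mul' := fun _ _ => rfl

/-- The Laplace operator `Δ = ∂²/∂x₁² + ⋯ + ∂²/∂xₙ²` on complex polynomials. -/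
def polyLaplacian (n : ℕ) : MvPolynomial (Fin n) ℂ →ₗ[ℂ] MvPolynomial (Fin n) ℂ :=
  ∑ i : Fin n, (MvPolynomial.pderiv i).toLinearMap ∘ₗ (MvPolynomial.pderiv i).toLinearMap

/-- The harmonic homogeneous polynomials of degree `k` in `n` variables (with `0`). -/
def Harm (n k : ℕ) : Submodule ℂ (MvPolynomial (Fin n) ℂ) :=
  MvPolynomial.homogeneousSubmodule (Fin n) ℂ k ⊓ LinearMap.ker (polyLaplacian n)

/-- The coordinate function `x ↦ xᵢ` on the sphere, as a complex-valued function. -/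
def coordFun {n : ℕ} (i : Fin n) : C(Sph n, ℂ) where
  toFun x := ((x.1 i : ℝ) : ℂ)
  continuous_toFun := by fun_prop

/-- Restriction of polynomial functions to the sphere, `p ↦ (x ↦ p(x₁, …, xₙ))`. -/
def restrictToSphere (n : ℕ) : MvPolynomial (Fin n) ℂ →ₐ[ℂ] C(Sph n, ℂ) :=
  MvPolynomial.aeval coordFun

/-- The space `H_k` of spherical harmonics of degree `k`. -/
def H (n k : ℕ) : Submodule ℂ C(Sph n, ℂ) :=
  (Harm n k).map (restrictToSphere n).toLinearMap

/-- `C(S^{n-1}) = V₀ ⊥ V₁ ⊥ V₂ ⊥ …`: the subspaces are pairwise orthogonal, and every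
continuous function is in exactly one way a sum `∑ fₖ` with `fₖ ∈ Vₖ`, where the series converges
in the mean. -/
def IsOrthogonalDecomposition {n : ℕ} (V : ℕ → Submodule ℂ C(Sph n, ℂ)) : Prop :=
  (∀ k l, k ≠ l → ∀ f ∈ V k, ∀ g ∈ V l, sphInner f g = 0) ∧
  ∀ f : C(Sph n, ℂ), ∃! h : ℕ → C(Sph n, ℂ),
    (∀ k, h k ∈ V k) ∧
    Filter.Tendsto (fun N => meanNorm (f - ∑ k ∈ Finset.range N, h k)) Filter.atTop (nhds 0)

/-- The invariant subspace `σ` is irreducible: it is nonzero, and `0` and `σ` are its only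
invariant subspaces. -/
def IsIrreducibleSub {G W : Type*} [Group G] [AddCommGroup W] [Module ℂ W]
    {ρ : Representation ℂ G W} (σ : Subrepresentation ρ) : Prop :=
  σ.toRepresentation.IsIrreducible

/-- Two invariant subspaces are equivalent: there is a bijective linear map between them that
commutes with the group action. -/
def AreEquivalentSub {G W : Type*} [Group G] [AddCommGroup W] [Module ℂ W]
    {ρ : Representation ℂ G W} (σ τ : Subrepresentation ρ) : Prop :=
  Nonempty (σ.toRepresentation.Equiv τ.toRepresentation)

end SphericalHarmonics

end

/-! The algebra rests on `polyLaplacian_normSqPoly_mul`: with r² = x₁² + ⋯ + xₙ², it makes q ↦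
Δ(r²q) injective on each homogeneous degree, hence bijective by finite dimension. So Δ is onto,
which gives the dimensions by rank-nullity, and every homogeneous polynomial is harmonic plus a
multiple of r². As r² = 1 on the sphere, all polynomial functions lie in the span of the H_k, and
Stone–Weierstrass makes that span dense. The same injectivity with a parity argument shows that the
H_k are linearly independent, before any orthogonality is known.

The representation theory rests on `exists_eq_smul_of_equivariant`. Evaluation at a pole is
represented on H_k by a nonzero zonal function w_k. Zonal functions in H_j for j ≤ k are polynomials
of degree at most k in x₀, a space of dimension at most k + 1 that contains the independent w_0, …,
w_k; so zonal functions in H_k are multiples of w_k. For equivariant T : H_k → C(S), the functional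
f ↦ (Tf)(pole) is represented by a zonal function, hence is a multiple of evaluation at the pole,
and transitivity makes T a scalar. Taking for T an orthogonal projection or an equivalence yields
orthogonality, irreducibility and inequivalence. Convergence follows from density and best
approximation. -/

noncomputable section

namespace SphericalHarmonics

open MeasureTheory MvPolynomial Filter Topology
open scoped Pointwise

/-! ### The Laplacian and multiplication by r² -/

/-- The polynomial `x₁² + ⋯ + xₙ²`. -/
def normSqPoly (n : ℕ) : MvPolynomial (Fin n) ℂ := ∑ i, X i ^ 2

lemma polyLaplacian_apply {n : ℕ} (p : MvPolynomial (Fin n) ℂ) :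
    polyLaplacian n p = ∑ i, pderiv i (pderiv i p) := by
  simp [polyLaplacian]

lemma mem_Harm {n k : ℕ} {p : MvPolynomial (Fin n) ℂ} :
    p ∈ Harm n k ↔ p.IsHomogeneous k ∧ polyLaplacian n p = 0 := by
  simp [Harm]

lemma isHomogeneous_normSqPoly (n : ℕ) : (normSqPoly n).IsHomogeneous 2 :=
  IsHomogeneous.sum _ _ _ fun i _ => by simpa using (isHomogeneous_X ℂ i).pow 2

lemma isHomogeneous_polyLaplacian {n k : ℕ} {p : MvPolynomial (Fin n) ℂ} (hp : p.IsHomogeneous k) :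
    (polyLaplacian n p).IsHomogeneous (k - 2) := by
  rw [polyLaplacian_apply]
  exact IsHomogeneous.sum _ _ _ fun i _ => by simpa [Nat.sub_sub] using hp.pderiv.pderiv

lemma polyLaplacian_eq_zero_of_lt_two {n k : ℕ} {p : MvPolynomial (Fin n) ℂ}
    (hp : p.IsHomogeneous k) (hk : k < 2) : polyLaplacian n p = 0 := by
  rw [polyLaplacian_apply]
  refine Finset.sum_eq_zero fun i _ => ?_
  have h : (pderiv i p).IsHomogeneous 0 := by
    simpa [show k - 1 = 0 by omega] using hp.pderiv (i := i)
  rw [← totalDegree_zero_iff_isHomogeneous, totalDegree_eq_zero_iff_eq_C] at h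
  rw [h, pderiv_C]

lemma pderiv_normSqPoly {n : ℕ} (i : Fin n) : pderiv i (normSqPoly n) = 2 * X i := by
  simp only [normSqPoly, map_sum, pderiv_pow, pderiv_X]
  rw [Finset.sum_eq_single i]
  · simp
  · intro j _ hj; simp [hj]
  · simp

/-- The product rule in each variable; Euler's identity turns the cross terms 4 xᵢ ∂ᵢq into 4m q. -/
lemma polyLaplacian_normSqPoly_mul {n m : ℕ} {q : MvPolynomial (Fin n) ℂ} (hq : q.IsHomogeneous m) :
    polyLaplacian n (normSqPoly n * q) =
      ((2 * n + 4 * m : ℕ) : ℂ) • q + normSqPoly n * polyLaplacian n q := by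
  have h : ∀ i, pderiv i (pderiv i (normSqPoly n * q)) =
      2 * q + 4 * (X i * pderiv i q) + normSqPoly n * pderiv i (pderiv i q) := by
    intro i
    have h2 : pderiv i (2 : MvPolynomial (Fin n) ℂ) = 0 := pderiv_C (a := (2 : ℂ))
    simp only [pderiv_mul, pderiv_normSqPoly, map_add, h2, pderiv_X_self]
    ring
  simp only [polyLaplacian_apply, h, Finset.sum_add_distrib, ← Finset.mul_sum,
    hq.sum_X_mul_pderiv]
  have h2 : (C 2 : MvPolynomial (Fin n) ℂ) = 2 := map_ofNat C 2
  have h4 : (C 4 : MvPolynomial (Fin n) ℂ) = 4 := map_ofNat C 4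
  simp [smul_eq_C_mul, h2, h4]
  ring

/-- Applying Δ gives an equation of the same shape for Δq with a larger constant, so an arbitrary c
> 0 is what the induction on the degree needs. -/
lemma eq_zero_of_smul_add_normSqPoly_mul {n m : ℕ} {q : MvPolynomial (Fin n) ℂ}
    (hq : q.IsHomogeneous m) {c : ℕ} (hc : 0 < c)
    (h : (c : ℂ) • q + normSqPoly n * polyLaplacian n q = 0) : q = 0 := by
  induction m using Nat.strong_induction_on generalizing q c with
  | _ m ih =>
  have hs : polyLaplacian n q = 0 := by
    rcases lt_or_ge m 2 with hm | hm
    · exact polyLaplacian_eq_zero_of_lt_two hq hm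
    · have hΔ := isHomogeneous_polyLaplacian hq
      refine ih (m - 2) (by omega) hΔ (c := c + (2 * n + 4 * (m - 2))) (by omega) ?_
      have := congrArg (polyLaplacian n) h
      rw [map_add, map_smul, polyLaplacian_normSqPoly_mul hΔ, map_zero, ← add_assoc,
        ← add_smul] at this
      exact_mod_cast this
  rw [hs, mul_zero, add_zero] at h
  exact (smul_eq_zero.1 h).resolve_left (by exact_mod_cast hc.ne')

lemma eq_zero_of_polyLaplacian_normSqPoly_mul {n m : ℕ} (hn : 0 < n)
    {q : MvPolynomial (Fin n) ℂ} (hq : q.IsHomogeneous m)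
    (h : polyLaplacian n (normSqPoly n * q) = 0) : q = 0 := by
  rw [polyLaplacian_normSqPoly_mul hq] at h
  exact eq_zero_of_smul_add_normSqPoly_mul hq (by omega) h

/-! ### Harmonic decomposition and dimension count -/

instance homogeneousSubmodule_finite (n k : ℕ) :
    Module.Finite ℂ (homogeneousSubmodule (Fin n) ℂ k) :=
  Module.Finite.iff_fg.2 (homogeneousSubmodule_fg (R := ℂ) (σ := Fin n) k)

/-- The Laplace operator from homogeneous polynomials of degree `k + 2` to those of degree `k`. -/
def homogeneousLaplacian (n k : ℕ) :
    homogeneousSubmodule (Fin n) ℂ (k + 2) →ₗ[ℂ] homogeneousSubmodule (Fin n) ℂ k :=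
  (polyLaplacian n).restrict fun p hp => by
    simpa using isHomogeneous_polyLaplacian (n := n) (k := k + 2) (p := p) hp

/-- Multiplication by `x₁² + ⋯ + xₙ²` on homogeneous polynomials of degree `k`. -/
def homogeneousMulNormSq (n k : ℕ) :
    homogeneousSubmodule (Fin n) ℂ k →ₗ[ℂ] homogeneousSubmodule (Fin n) ℂ (k + 2) :=
  (LinearMap.mulLeft ℂ (normSqPoly n)).restrict fun p (hp : p.IsHomogeneous k) => by
    simpa [add_comm] using (isHomogeneous_normSqPoly n).mul hp

/-- An injective endomorphism of a finite-dimensional space is onto. -/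
lemma surjective_homogeneousLaplacian_comp {n : ℕ} (hn : 0 < n) (k : ℕ) :
    Function.Surjective (homogeneousLaplacian n k ∘ₗ homogeneousMulNormSq n k) := by
  rw [← LinearMap.injective_iff_surjective, injective_iff_map_eq_zero]
  rintro ⟨q, hq⟩ h
  exact Subtype.ext (eq_zero_of_polyLaplacian_normSqPoly_mul hn hq (congrArg Subtype.val h))

lemma surjective_homogeneousLaplacian {n : ℕ} (hn : 0 < n) (k : ℕ) :
    Function.Surjective (homogeneousLaplacian n k) :=
  Function.Surjective.of_comp (surjective_homogeneousLaplacian_comp hn k)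

/-- Every homogeneous polynomial of degree `k + 2` is the sum of a harmonic one and a multiple of
`x₁² + ⋯ + xₙ²`. -/
lemma exists_harm_add_normSqPoly_mul {n k : ℕ} (hn : 0 < n) {p : MvPolynomial (Fin n) ℂ}
    (hp : p.IsHomogeneous (k + 2)) :
    ∃ h ∈ Harm n (k + 2), ∃ q : MvPolynomial (Fin n) ℂ, q.IsHomogeneous k ∧
      p = h + normSqPoly n * q := by
  obtain ⟨⟨q, hq⟩, h⟩ := surjective_homogeneousLaplacian_comp hn k
    (homogeneousLaplacian n k ⟨p, hp⟩)
  have h' : polyLaplacian n (normSqPoly n * q) = polyLaplacian n p := congrArg Subtype.val h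
  refine ⟨p - normSqPoly n * q, mem_Harm.2 ⟨?_, by rw [map_sub, h', sub_self]⟩, q, hq, by ring⟩
  exact hp.sub (by simpa [add_comm] using (isHomogeneous_normSqPoly n).mul hq)

lemma finrank_homogeneousSubmodule (n k : ℕ) (hn : 0 < n) :
    Module.finrank ℂ (homogeneousSubmodule (Fin n) ℂ k) = (n + k - 1).choose (n - 1) := by
  rw [homogeneousSubmodule_eq_finsupp_supported]
  have b : Module.Basis {d : Fin n →₀ ℕ | d.degree = k} ℂ
      (AddMonoidAlgebra.supported ℂ ℂ {d : Fin n →₀ ℕ | d.degree = k}) :=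
    Module.Basis.ofRepr (AddMonoidAlgebra.supportedEquivFinsupp _)
  rw [Module.finrank_eq_nat_card_basis b]
  have e : Sym (Fin n) k ≃ {d : Fin n →₀ ℕ | d.degree = k} := Sym.equivNatSum (Fin n) k
  rw [← Nat.card_congr e, Sym.natCard_sym_eq_choose, Nat.card_fin]
  rw [← Nat.choose_symm (by omega)]
  congr 1
  omega

lemma finrank_Harm_add_two {n : ℕ} (hn : 0 < n) (k : ℕ) :
    Module.finrank ℂ (Harm n (k + 2)) + Module.finrank ℂ (homogeneousSubmodule (Fin n) ℂ k) =
      Module.finrank ℂ (homogeneousSubmodule (Fin n) ℂ (k + 2)) := by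
  have h := LinearMap.finrank_range_add_finrank_ker (homogeneousLaplacian n k)
  rw [LinearMap.range_eq_top.2 (surjective_homogeneousLaplacian hn k), finrank_top] at h
  have e : Module.finrank ℂ (LinearMap.ker (homogeneousLaplacian n k)) =
      Module.finrank ℂ (Harm n (k + 2)) := by
    rw [homogeneousLaplacian, LinearMap.ker_restrict]
    rw [← Submodule.finrank_map_subtype_eq, Submodule.map_comap_subtype]
    rfl
  omega

lemma Harm_eq_homogeneousSubmodule {n k : ℕ} (hk : k < 2) :
    Harm n k = homogeneousSubmodule (Fin n) ℂ k :=
  le_antisymm inf_le_left fun _ hp => ⟨hp, polyLaplacian_eq_zero_of_lt_two hp hk⟩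

/-! ### Orthogonal invariance of harmonic polynomials -/

lemma pderiv_aeval {n : ℕ} (g : Fin n → MvPolynomial (Fin n) ℂ) (p : MvPolynomial (Fin n) ℂ)
    (j : Fin n) :
    pderiv j (aeval g p) = ∑ i, aeval g (pderiv i p) * pderiv j (g i) := by
  induction p using MvPolynomial.induction_on with
  | C a => simp
  | add p q hp hq => simp only [map_add, hp, hq, add_mul, Finset.sum_add_distrib]
  | mul_X p k hp =>
    have h : ∀ i, aeval g (pderiv i (p * X k)) * pderiv j (g i) =
        aeval g (pderiv i p) * pderiv j (g i) * g k +
          if i = k then aeval g p * pderiv j (g k) else 0 := by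
      intro i
      rw [pderiv_mul, map_add, map_mul, map_mul, aeval_X]
      split_ifs with hik
      · subst hik
        rw [pderiv_X_self, map_one]
        ring
      · rw [pderiv_X_of_ne (Ne.symm hik), map_zero]
        ring
    simp only [h]
    rw [map_mul, aeval_X, pderiv_mul, hp, Finset.sum_add_distrib, Finset.sum_mul,
      Finset.sum_ite_eq' Finset.univ k, if_pos (Finset.mem_univ k)]

/-- The linear form with coefficients `(u eᵢ)ⱼ`, whose value at `x` is the `i`-th coordinate of
`u⁻¹ x`. -/
def rotatedCoord {n : ℕ} (u : OGroup n) (i : Fin n) : MvPolynomial (Fin n) ℂ :=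
  ∑ j, C ((u (EuclideanSpace.single i 1) j : ℝ) : ℂ) * X j

lemma pderiv_rotatedCoord {n : ℕ} (u : OGroup n) (i j : Fin n) :
    pderiv j (rotatedCoord u i) = C ((u (EuclideanSpace.single i 1) j : ℝ) : ℂ) := by
  simp only [rotatedCoord, map_sum, pderiv_C_mul, pderiv_X]
  rw [Finset.sum_eq_single j]
  · simp
  · intro k _ hk; simp [hk]
  · simp

lemma sum_orthogonal_coeff {n : ℕ} (u : OGroup n) (i l : Fin n) :
    ∑ j, ((u (EuclideanSpace.single i 1) j : ℝ) : ℂ) * ((u (EuclideanSpace.single l 1) j : ℝ) : ℂ)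
      = if i = l then 1 else 0 := by
  have h := u.inner_map_map (EuclideanSpace.single l 1) (EuclideanSpace.single i 1)
  rw [PiLp.inner_apply] at h
  simp only [RCLike.inner_apply, conj_trivial, EuclideanSpace.inner_single_left, one_mul,
    PiLp.single_apply] at h
  simp only [eq_comm (a := i)]
  have h' := congrArg Complex.ofReal h
  rw [apply_ite Complex.ofReal] at h'
  simpa using h'

/-- The chain rule, used twice, produces all mixed second derivatives; orthonormality of the vectors
u eᵢ leaves only the diagonal ones. -/
lemma polyLaplacian_aeval_rotatedCoord {n : ℕ} (u : OGroup n) (p : MvPolynomial (Fin n) ℂ) :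
    polyLaplacian n (aeval (rotatedCoord u) p) = aeval (rotatedCoord u) (polyLaplacian n p) := by
  have h : ∀ j, pderiv j (pderiv j (aeval (rotatedCoord u) p)) = ∑ i, ∑ l,
      aeval (rotatedCoord u) (pderiv l (pderiv i p)) *
        C (((u (EuclideanSpace.single i 1) j : ℝ) : ℂ) *
          ((u (EuclideanSpace.single l 1) j : ℝ) : ℂ)) := by
    intro j
    simp only [pderiv_aeval, map_sum, pderiv_rotatedCoord, pderiv_mul, pderiv_C, mul_zero,
      add_zero, Finset.sum_mul, map_mul]
    exact Finset.sum_congr rfl fun i _ => Finset.sum_congr rfl fun l _ => by ring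
  simp only [polyLaplacian_apply, h, map_sum]
  rw [Finset.sum_comm]
  refine Finset.sum_congr rfl fun i _ => ?_
  rw [Finset.sum_comm]
  simp only [← Finset.mul_sum, ← map_sum, sum_orthogonal_coeff]
  simp

lemma isHomogeneous_rotatedCoord {n : ℕ} (u : OGroup n) (i : Fin n) :
    (rotatedCoord u i).IsHomogeneous 1 :=
  IsHomogeneous.sum _ _ _ fun j _ => by simpa using (isHomogeneous_C _ _).mul (isHomogeneous_X ℂ j)

lemma aeval_rotatedCoord_mem_Harm {n k : ℕ} (u : OGroup n) {p : MvPolynomial (Fin n) ℂ}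
    (hp : p ∈ Harm n k) : aeval (rotatedCoord u) p ∈ Harm n k := by
  rw [mem_Harm] at hp ⊢
  refine ⟨by simpa using hp.1.aeval _ (isHomogeneous_rotatedCoord u), ?_⟩
  rw [polyLaplacian_aeval_rotatedCoord, hp.2, map_zero]

lemma restrictToSphere_apply {n : ℕ} (p : MvPolynomial (Fin n) ℂ) (x : Sph n) :
    restrictToSphere n p x = eval (fun i => ((x.1 i : ℝ) : ℂ)) p := by
  induction p using MvPolynomial.induction_on with
  | C a => simp [restrictToSphere]
  | add p q hp hq => simp [hp, hq]
  | mul_X p i hp => simp [hp]; left; simp [restrictToSphere, coordFun]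

lemma sphRep_apply {n : ℕ} (u : OGroup n) (f : C(Sph n, ℂ)) (x : Sph n) :
    sphRep n u f x = f (actSphere u⁻¹ x) := rfl

lemma sphRep_restrictToSphere {n : ℕ} (u : OGroup n) (p : MvPolynomial (Fin n) ℂ) :
    sphRep n u (restrictToSphere n p) = restrictToSphere n (aeval (rotatedCoord u) p) := by
  ext x
  rw [sphRep_apply, restrictToSphere_apply, restrictToSphere_apply]
  have : ∀ i, (((actSphere u⁻¹ x).1 i : ℝ) : ℂ) =
      eval (fun i => ((x.1 i : ℝ) : ℂ)) (rotatedCoord u i) := by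
    intro i
    have h : (u⁻¹ x.1) i = inner ℝ (u (EuclideanSpace.single i 1)) x.1 := by
      have := u.inner_map_map (EuclideanSpace.single i 1) (u⁻¹ x.1)
      rw [EuclideanSpace.inner_single_left, map_one, one_mul] at this
      rw [← this]
      exact congrArg _ (u.apply_symm_apply x.1)
    change (((u⁻¹ x.1) i : ℝ) : ℂ) = _
    rw [h, PiLp.inner_apply]
    simp [rotatedCoord, mul_comm]
  simp only [this]
  induction p using MvPolynomial.induction_on with
  | C a => simp
  | add p q hp hq => simp [hp, hq]
  | mul_X p i hp => simp [hp]

lemma sphRep_mem_H {n k : ℕ} (u : OGroup n) {f : C(Sph n, ℂ)} (hf : f ∈ H n k) :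
    sphRep n u f ∈ H n k := by
  obtain ⟨p, hp, rfl⟩ := hf
  exact ⟨_, aeval_rotatedCoord_mem_Harm u hp, (sphRep_restrictToSphere u p).symm⟩

/-! ### Restriction to the sphere and linear independence of the degrees -/

lemma eval_smul_of_isHomogeneous {σ R : Type*} [CommSemiring R] {p : MvPolynomial σ R} {k : ℕ}
    (hp : p.IsHomogeneous k) (c : R) (v : σ → R) : eval (c • v) p = c ^ k * eval v p := by
  rw [eval_eq, eval_eq, Finset.mul_sum]
  refine Finset.sum_congr rfl fun d hd => ?_
  have hk : ∑ i ∈ d.support, d i = k := by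
    have := hp (mem_support_iff.1 hd)
    rw [← this, Finsupp.weight_apply]; simp [Finsupp.sum]
  simp only [Pi.smul_apply, smul_eq_mul, mul_pow, Finset.prod_mul_distrib,
    Finset.prod_pow_eq_pow_sum, hk]
  ring

lemma restrictToSphere_neg {n k : ℕ} {p : MvPolynomial (Fin n) ℂ} (hp : p.IsHomogeneous k)
    (x : Sph n) : restrictToSphere n p (-x) = (-1) ^ k * restrictToSphere n p x := by
  rw [restrictToSphere_apply, restrictToSphere_apply, ← eval_smul_of_isHomogeneous hp]
  congr 2
  ext i
  simp

/-- By homogeneity the polynomial vanishes on every real vector, and ℝ is an infinite subset of ℂ.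
-/
lemma eq_zero_of_restrictToSphere_eq_zero {n k : ℕ} (hn : 0 < n) {p : MvPolynomial (Fin n) ℂ}
    (hp : p.IsHomogeneous k) (h : restrictToSphere n p = 0) : p = 0 := by
  refine funext_set (fun _ => Set.range ((↑) : ℝ → ℂ))
    (fun _ => Set.infinite_range_of_injective Complex.ofReal_injective) fun v hv => ?_
  choose y hy using fun i => hv i trivial
  have hz : ∃ x : Sph n, ∃ r : ℝ, ∀ i, y i = r * x.1 i := by
    have : NeZero n := ⟨hn.ne'⟩
    by_cases h0 : WithLp.toLp 2 y = 0
    · exact ⟨⟨EuclideanSpace.single 0 1, by simp⟩, 0, fun i => by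
        simpa using congrArg (fun z : EuclideanSpace ℝ (Fin n) => z i) h0⟩
    · have h1 : ‖WithLp.toLp 2 y‖ ≠ 0 := norm_ne_zero_iff.2 h0
      refine ⟨⟨‖WithLp.toLp 2 y‖⁻¹ • WithLp.toLp 2 y, ?_⟩, ‖WithLp.toLp 2 y‖, fun i => ?_⟩
      · rw [mem_sphere_zero_iff_norm, norm_smul, norm_inv, norm_norm, inv_mul_cancel₀ h1]
      · simp [h1]
  obtain ⟨x, r, hx⟩ := hz
  have hv' : v = (r : ℂ) • fun i => ((x.1 i : ℝ) : ℂ) := by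
    ext i
    rw [← hy i, hx i]
    simp
  rw [hv', eval_smul_of_isHomogeneous hp, ← restrictToSphere_apply, h]
  simp

lemma restrictToSphere_normSqPoly (n : ℕ) : restrictToSphere n (normSqPoly n) = 1 := by
  ext x
  rw [restrictToSphere_apply]
  have h : ∑ i, x.1 i ^ 2 = 1 := by
    have := EuclideanSpace.norm_sq_eq x.1
    simpa using this.symm
  simp only [normSqPoly, map_sum, map_pow, eval_X, ContinuousMap.one_apply]
  exact_mod_cast h

/-- The leading term of a vanishing sum of spherical harmonics vanishes. -/
lemma eq_zero_of_sum_restrictToSphere_eq_zero {n m : ℕ} (hn : 0 < n)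
    {h : ℕ → MvPolynomial (Fin n) ℂ} (hh : ∀ j, h j ∈ Harm n j)
    (hsum : ∑ j ∈ Finset.range (m + 1), restrictToSphere n (h j) = 0) : h m = 0 := by
  simp only [mem_Harm] at hh
  -- For j < m of the parity of m, r² t_j is the lift of h_j to degree m with the same values on the
  -- sphere; the other parity is dropped.
  set t : ℕ → MvPolynomial (Fin n) ℂ := fun j =>
    if Even (m - j) then normSqPoly n ^ ((m - j) / 2 - 1) * h j else 0 with ht
  have htm : ∀ j ∈ Finset.range m, (t j).IsHomogeneous (m - 2) ∧
      (normSqPoly n * t j).IsHomogeneous m := by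
    intro j hj
    rw [Finset.mem_range] at hj
    by_cases he : Even (m - j)
    · have h1 : (t j).IsHomogeneous (m - 2) := by
        have := ((isHomogeneous_normSqPoly n).pow ((m - j) / 2 - 1)).mul (hh j).1
        obtain ⟨c, hc⟩ := he
        rw [show 2 * ((m - j) / 2 - 1) + j = m - 2 by omega] at this
        simpa [ht, show Even (m - j) from ⟨c, hc⟩] using this
      refine ⟨h1, ?_⟩
      have := (isHomogeneous_normSqPoly n).mul h1
      obtain ⟨c, hc⟩ := he
      rwa [show 2 + (m - 2) = m by omega] at this
    · simp [ht, he, isHomogeneous_zero]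
  set q := ∑ j ∈ Finset.range m, t j with hq
  have hqm : q.IsHomogeneous (m - 2) := IsHomogeneous.sum _ _ _ fun j hj => (htm j hj).1
  have hP : h m + normSqPoly n * q = 0 := by
    refine eq_zero_of_restrictToSphere_eq_zero (k := m) hn ?_ ?_
    · refine (hh m).1.add ?_
      rw [hq, Finset.mul_sum]
      exact IsHomogeneous.sum _ _ _ fun j hj => (htm j hj).2
    · ext x
      -- Combining the relation at x and at −x isolates the terms whose degree has the parity of m.
      have h1 := DFunLike.congr_fun hsum x
      have h2 := DFunLike.congr_fun hsum (-x)
      rw [Finset.sum_range_succ] at h1 h2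
      simp only [ContinuousMap.add_apply, ContinuousMap.sum_apply, ContinuousMap.zero_apply,
        restrictToSphere_neg (hh _).1] at h1 h2
      have ht' : ∀ j ∈ Finset.range m, restrictToSphere n (t j) x =
          (restrictToSphere n (h j) x + (-1) ^ m * ((-1) ^ j * restrictToSphere n (h j) x)) / 2 := by
        intro j hj
        have hj := Finset.mem_range.1 hj
        rw [← mul_assoc, ← pow_add, show m + j = (m - j) + 2 * j by omega, pow_add, pow_mul]
        by_cases he : Even (m - j)
        · simp [ht, he, restrictToSphere_normSqPoly]
        · simp [ht, he, (Nat.not_even_iff_odd.1 he).neg_one_pow]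
      rw [map_add, map_mul, restrictToSphere_normSqPoly, one_mul, hq, map_sum]
      simp only [ContinuousMap.add_apply, ContinuousMap.sum_apply, ContinuousMap.zero_apply]
      rw [Finset.sum_congr rfl ht', ← Finset.sum_div, Finset.sum_add_distrib, ← Finset.mul_sum]
      have hm : ((-1 : ℂ) ^ m) * (-1) ^ m = 1 := by rw [← mul_pow]; simp
      linear_combination (1 / 2 : ℂ) * h1 + (1 / 2 : ℂ) * (-1) ^ m * h2 -
        (1 / 2 : ℂ) * restrictToSphere n (h m) x * hm
  have hΔ : polyLaplacian n (normSqPoly n * q) = 0 := by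
    rw [← neg_eq_of_add_eq_zero_right hP, map_neg, (hh m).2, neg_zero]
  rw [eq_zero_of_polyLaplacian_normSqPoly_mul hn hqm hΔ] at hP
  simpa using hP

/-- A linear equivalence between harmonic polynomials and spherical harmonics of degree `k`. -/
def harmEquiv {n : ℕ} (hn : 0 < n) (k : ℕ) : Harm n k ≃ₗ[ℂ] H n k :=
  LinearEquiv.ofBijective (((restrictToSphere n).toLinearMap).submoduleMap (Harm n k))
    ⟨by
      rw [injective_iff_map_eq_zero]
      rintro ⟨p, hp⟩ h
      exact Subtype.ext (eq_zero_of_restrictToSphere_eq_zero hn (mem_Harm.1 hp).1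
        (congrArg Subtype.val h)), LinearMap.submoduleMap_surjective _ _⟩

instance Harm_finite (n k : ℕ) : Module.Finite ℂ (Harm n k) :=
  Submodule.finiteDimensional_of_le (inf_le_left : _ ≤ homogeneousSubmodule (Fin n) ℂ k)

instance H_finite (n k : ℕ) : Module.Finite ℂ (H n k) :=
  Module.Finite.map _ _

lemma finrank_H_add {n : ℕ} (hn : 2 ≤ n) (k : ℕ) :
    Module.finrank ℂ (H n k) + (n + k - 3).choose (n - 1) = (n + k - 1).choose (n - 1) := by
  rw [← (harmEquiv (by omega) k).finrank_eq]
  rcases lt_or_ge k 2 with hk | hk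
  · rw [Harm_eq_homogeneousSubmodule hk, finrank_homogeneousSubmodule n k (by omega),
      Nat.choose_eq_zero_of_lt (by omega : n + k - 3 < n - 1), add_zero]
  · obtain ⟨k, rfl⟩ := Nat.exists_eq_add_of_le' hk
    have := finrank_Harm_add_two (show 0 < n by omega) k
    rw [finrank_homogeneousSubmodule n _ (by omega), finrank_homogeneousSubmodule n _ (by omega)]
      at this
    rwa [show n + (k + 2) - 3 = n + k - 1 by omega]

lemma finrank_H_pos {n : ℕ} (hn : 2 ≤ n) (k : ℕ) : 0 < Module.finrank ℂ (H n k) := by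
  have h := finrank_H_add hn k
  have h1 : (n + k - 3).choose (n - 1) ≤ (n + k - 2).choose (n - 1) :=
    Nat.choose_le_choose _ (by omega)
  have h2 := Nat.choose_succ_succ (n + k - 2) (n - 2)
  have h3 : 0 < (n + k - 2).choose (n - 2) := Nat.choose_pos (by omega)
  rw [Nat.succ_eq_add_one, Nat.succ_eq_add_one, show n + k - 2 + 1 = n + k - 1 by omega,
    show n - 2 + 1 = n - 1 by omega] at h2
  omega

lemma H_ne_bot {n : ℕ} (hn : 2 ≤ n) (k : ℕ) : H n k ≠ ⊥ := fun h => by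
  have := finrank_H_pos hn k
  rw [h, finrank_bot] at this
  exact this.false

/-- The leading term of a vanishing sum of spherical harmonics vanishes. -/
lemma eq_zero_of_sum_eq_zero {n m : ℕ} (hn : 0 < n) {h : ℕ → C(Sph n, ℂ)} (hh : ∀ j, h j ∈ H n j)
    (hsum : ∑ j ∈ Finset.range (m + 1), h j = 0) : h m = 0 := by
  choose p hp hph using hh
  have := eq_zero_of_sum_restrictToSphere_eq_zero (m := m) hn hp (by
    rw [← hsum]; exact Finset.sum_congr rfl fun j _ => hph j)
  rw [← hph m, this, map_zero]

/-- Restrictions of homogeneous polynomials of degree `k` are sums of spherical harmonics of degree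
at most `k`. -/
lemma restrictToSphere_mem_iSup_H {n k : ℕ} (hn : 0 < n) {p : MvPolynomial (Fin n) ℂ}
    (hp : p.IsHomogeneous k) : restrictToSphere n p ∈ ⨆ j, H n j := by
  induction k using Nat.strong_induction_on generalizing p with
  | _ k ih =>
  rcases lt_or_ge k 2 with hk | hk
  · exact Submodule.mem_iSup_of_mem k
      ⟨p, mem_Harm.2 ⟨hp, polyLaplacian_eq_zero_of_lt_two hp hk⟩, rfl⟩
  · obtain ⟨k, rfl⟩ := Nat.exists_eq_add_of_le' hk
    obtain ⟨h, hh, q, hq, rfl⟩ := exists_harm_add_normSqPoly_mul hn hp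
    rw [map_add, map_mul, restrictToSphere_normSqPoly, one_mul]
    exact add_mem (Submodule.mem_iSup_of_mem (k + 2) ⟨h, hh, rfl⟩) (ih k (by omega) hq)

lemma range_restrictToSphere_le {n : ℕ} (hn : 0 < n) (p : MvPolynomial (Fin n) ℂ) :
    restrictToSphere n p ∈ ⨆ j, H n j := by
  rw [← sum_homogeneousComponent p, map_sum]
  exact sum_mem fun i _ => restrictToSphere_mem_iSup_H hn (homogeneousComponent_isHomogeneous i p)

/-! ### Invariant measure, L² and orthogonal projections -/

instance (n : ℕ) : IsFiniteMeasure (surfaceMeasure n) := by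
  unfold surfaceMeasure; infer_instance

instance (n : ℕ) : (surfaceMeasure n).IsOpenPosMeasure := by
  unfold surfaceMeasure; infer_instance

/-- Surface measure is a multiple of the volume of the cone over a set, and u preserves volume and
commutes with forming cones. -/
lemma measurePreserving_actSphere {n : ℕ} (u : OGroup n) :
    MeasurePreserving (actSphere u) (surfaceMeasure n) (surfaceMeasure n) := by
  have hm : Measurable (actSphere u) := (actSphere u).continuous.measurable
  refine ⟨hm, Measure.ext fun s hs => ?_⟩
  rw [Measure.map_apply hm hs, surfaceMeasure, Measure.toSphere_apply' _ (hm hs),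
    Measure.toSphere_apply' _ hs,
    ← u.measurePreserving.measure_preimage_emb u.toHomeomorph.measurableEmbedding
      (Set.Ioo (0 : ℝ) 1 • (Subtype.val '' s))]
  congr 2
  ext z
  simp only [Set.mem_preimage, Set.mem_smul, Set.mem_image]
  constructor
  · rintro ⟨r, hr, _, ⟨x, hx, rfl⟩, rfl⟩
    exact ⟨r, hr, _, ⟨_, hx, rfl⟩, (map_smul u r x.1).symm⟩
  · rintro ⟨r, hr, _, ⟨x, hx, rfl⟩, h⟩
    refine ⟨r, hr, u.symm x.1, ⟨⟨u.symm x.1, by simp⟩, ?_, rfl⟩, ?_⟩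
    · convert hx
      exact Subtype.ext (u.apply_symm_apply x.1)
    · apply u.injective
      rw [map_smul, u.apply_symm_apply, h]

/-- The embedding of `C(S^{n-1})` into the Hilbert space of square integrable functions. -/
def toL2 (n : ℕ) : C(Sph n, ℂ) →L[ℂ] Lp ℂ 2 (surfaceMeasure n) :=
  ContinuousMap.toLp 2 (surfaceMeasure n) ℂ

lemma toL2_injective (n : ℕ) : Function.Injective (toL2 n) :=
  ContinuousMap.toLp_injective _

lemma sphInner_eq_inner {n : ℕ} (f g : C(Sph n, ℂ)) :
    sphInner f g = inner ℂ (toL2 n g) (toL2 n f) :=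
  (ContinuousMap.inner_toLp (surfaceMeasure n) g f).symm

lemma meanNorm_eq_norm {n : ℕ} (f : C(Sph n, ℂ)) : meanNorm f = ‖toL2 n f‖ := by
  rw [meanNorm, sphInner_eq_inner, norm_eq_sqrt_re_inner (𝕜 := ℂ)]
  rfl

lemma sphInner_sphRep {n : ℕ} (u : OGroup n) (f g : C(Sph n, ℂ)) :
    sphInner (sphRep n u f) (sphRep n u g) = sphInner f g := by
  have h := (measurePreserving_actSphere u⁻¹).integral_comp'
    (f := ⟨⟨actSphere u⁻¹, actSphere u, fun x => Subtype.ext (u.apply_symm_apply x.1),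
      fun x => Subtype.ext (u.symm_apply_apply x.1)⟩,
      (actSphere u⁻¹).continuous.measurable, (actSphere u).continuous.measurable⟩)
    (fun x => f x * (starRingEnd ℂ) (g x))
  exact h

lemma sphInner_sphRep_left {n : ℕ} (u : OGroup n) (f g : C(Sph n, ℂ)) :
    sphInner (sphRep n u f) g = sphInner f (sphRep n u⁻¹ g) := by
  rw [← sphInner_sphRep u f, Representation.self_inv_apply]

lemma eq_of_forall_sphInner_eq {n : ℕ} {W : Submodule ℂ C(Sph n, ℂ)} {f g : C(Sph n, ℂ)}
    (hf : f ∈ W) (hg : g ∈ W) (h : ∀ v ∈ W, sphInner f v = sphInner g v) : f = g := by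
  have h1 := h (f - g) (sub_mem hf hg)
  rw [sphInner_eq_inner, sphInner_eq_inner, ← sub_eq_zero, ← inner_sub_right, ← map_sub,
    inner_self_eq_zero, ← map_zero (toL2 n)] at h1
  exact sub_eq_zero.1 (toL2_injective n h1)

section Projection

variable {n : ℕ} (W : Submodule ℂ C(Sph n, ℂ))

/-- The image in `L²` of a space of continuous functions, as an isomorphic vector space. -/
def equivMapToL2 : W ≃ₗ[ℂ] W.map (toL2 n : C(Sph n, ℂ) →ₗ[ℂ] Lp ℂ 2 (surfaceMeasure n)) :=
  Submodule.equivMapOfInjective _ (toL2_injective n) W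

lemma toL2_equivMapToL2_symm (y : W.map (toL2 n : C(Sph n, ℂ) →ₗ[ℂ] Lp ℂ 2 (surfaceMeasure n))) :
    toL2 n ((equivMapToL2 W).symm y) = y :=
  congrArg Subtype.val ((equivMapToL2 W).apply_symm_apply y)

variable [FiniteDimensional ℂ W]

instance : FiniteDimensional ℂ
    (W.map (toL2 n : C(Sph n, ℂ) →ₗ[ℂ] Lp ℂ 2 (surfaceMeasure n))) :=
  Module.Finite.map _ _

/-- The orthogonal projection of `C(S^{n-1})` onto a finite-dimensional subspace. -/
def proj : C(Sph n, ℂ) →ₗ[ℂ] W :=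
  (equivMapToL2 W).symm.toLinearMap ∘ₗ
    (W.map (toL2 n : C(Sph n, ℂ) →ₗ[ℂ] Lp ℂ 2 (surfaceMeasure n))).orthogonalProjectionOnto.toLinearMap
      ∘ₗ (toL2 n).toLinearMap

lemma sphInner_proj (f : C(Sph n, ℂ)) {g : C(Sph n, ℂ)} (hg : g ∈ W) :
    sphInner (proj W f : C(Sph n, ℂ)) g = sphInner f g := by
  rw [sphInner_eq_inner, sphInner_eq_inner, proj]
  simp only [LinearMap.comp_apply, LinearEquiv.coe_coe, toL2_equivMapToL2_symm]
  exact Submodule.inner_orthogonalProjectionOnto_eq_of_mem_left (𝕜 := ℂ)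
    ⟨toL2 n g, Submodule.mem_map_of_mem hg⟩ (toL2 n f)

/-- A linear functional on a finite-dimensional space of continuous functions is given by the inner
product with one of them. -/
lemma exists_eq_sphInner (l : W →ₗ[ℂ] ℂ) :
    ∃ w ∈ W, ∀ f : W, l f = sphInner (f : C(Sph n, ℂ)) w := by
  set K := W.map (toL2 n : C(Sph n, ℂ) →ₗ[ℂ] Lp ℂ 2 (surfaceMeasure n))
  set y := (InnerProductSpace.toDual ℂ K).symm
    (LinearMap.toContinuousLinearMap (l ∘ₗ (equivMapToL2 W).symm.toLinearMap)) with hy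
  refine ⟨(equivMapToL2 W).symm y, Subtype.property _, fun f => ?_⟩
  rw [sphInner_eq_inner, toL2_equivMapToL2_symm]
  have h : inner ℂ y (equivMapToL2 W f) = l f := by
    rw [hy, InnerProductSpace.toDual_symm_apply]
    simp
  rw [← h]
  rfl

end Projection

/-- The action is unitary, so both sides have the same inner products with the invariant space W. -/
lemma proj_sphRep {n : ℕ} (W : Submodule ℂ C(Sph n, ℂ)) [FiniteDimensional ℂ W]
    (hW : ∀ u, ∀ f ∈ W, sphRep n u f ∈ W) (u : OGroup n) (f : C(Sph n, ℂ)) :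
    (proj W (sphRep n u f) : C(Sph n, ℂ)) = sphRep n u (proj W f) := by
  refine eq_of_forall_sphInner_eq (proj W _).2 (hW u _ (proj W f).2) fun g hg => ?_
  rw [sphInner_proj W _ hg, sphInner_sphRep_left, sphInner_sphRep_left,
    sphInner_proj W _ (hW _ _ hg)]

/-- The reflection in the hyperplane orthogonal to x − y. The fixed points give the stabilizer of
the pole enough elements. -/
lemma exists_actSphere_eq {n : ℕ} (x y : Sph n) :
    ∃ u : OGroup n, actSphere u x = y ∧
      ∀ z : Sph n, inner ℝ z.1 x.1 = inner ℝ z.1 y.1 → actSphere u z = z := by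
  refine ⟨(ℝ ∙ (x.1 - y.1))ᗮ.reflection, Subtype.ext ?_, fun z hz => Subtype.ext ?_⟩
  · exact Submodule.reflection_sub (by simp)
  · refine Submodule.reflection_mem_subspace_eq_self ?_
    rw [Submodule.mem_orthogonal_singleton_iff_inner_left, inner_sub_right, hz, sub_self]

lemma eq_zero_of_sum_range_eq_zero {n m : ℕ} (hn : 0 < n) {h : ℕ → C(Sph n, ℂ)}
    (hh : ∀ j, h j ∈ H n j) (hsum : ∑ j ∈ Finset.range m, h j = 0) : ∀ j < m, h j = 0 := by
  induction m with
  | zero => simp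
  | succ m ih =>
    have hm := eq_zero_of_sum_eq_zero hn hh hsum
    rw [Finset.sum_range_succ, hm, add_zero] at hsum
    intro j hj
    rcases Nat.lt_succ_iff_lt_or_eq.1 hj with hj | rfl
    exacts [ih hsum j hj, hm]

lemma H_inf_H {n k l : ℕ} (hn : 0 < n) (hkl : k ≠ l) : H n k ⊓ H n l = ⊥ := by
  rw [eq_bot_iff]
  rintro f ⟨hk, hl⟩
  -- The family with f in degree k and −f in degree l sums to zero.
  have h := eq_zero_of_sum_range_eq_zero (m := k + l + 1) hn
    (h := fun j => if j = k then f else if j = l then -f else 0) (fun j => by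
      by_cases h1 : j = k
      · simpa [h1] using hk
      · by_cases h2 : j = l
        · simpa [h1, h2, hkl.symm] using neg_mem hl
        · simp [h1, h2]) (by
      have : ∀ j, (if j = k then f else if j = l then -f else 0) =
          (if j = k then f else 0) + (if j = l then -f else 0) := by
        intro j
        by_cases h1 : j = k
        · simp [h1, hkl]
        · simp [h1]
      simp only [this, Finset.sum_add_distrib, Finset.sum_ite_eq', Finset.mem_range]
      rw [if_pos (by omega), if_pos (by omega), add_neg_cancel]) k (by omega)
  simpa using h

/-! ### Zonal functions -/

/-- The first unit vector. -/
def pole (m : ℕ) : Sph (m + 2) := ⟨EuclideanSpace.single 0 1, by simp⟩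

/-- A function on the sphere is zonal if it is invariant under the stabilizer of the pole. -/
def IsZonal {m : ℕ} (f : C(Sph (m + 2), ℂ)) : Prop :=
  ∀ u : OGroup (m + 2), actSphere u (pole m) = pole m → sphRep (m + 2) u f = f

lemma actSphere_inv_actSphere {n : ℕ} (u : OGroup n) (x : Sph n) :
    actSphere u⁻¹ (actSphere u x) = x :=
  Subtype.ext (u.symm_apply_apply x.1)

lemma actSphere_inv_eq {n : ℕ} {u : OGroup n} {x y : Sph n} (h : actSphere u x = y) :
    actSphere u⁻¹ y = x := by
  rw [← h, actSphere_inv_actSphere]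

lemma sphRep_inv_apply {n : ℕ} (u : OGroup n) (f : C(Sph n, ℂ)) (x : Sph n) :
    sphRep n u⁻¹ f x = f (actSphere u x) := by
  rw [sphRep_apply, inv_inv]

/-- The reflection exchanging x and y fixes the pole when their first coordinates agree. -/
lemma IsZonal.apply_eq {m : ℕ} {f : C(Sph (m + 2), ℂ)} (hf : IsZonal f) {x y : Sph (m + 2)}
    (h : x.1 0 = y.1 0) : f x = f y := by
  obtain ⟨u, hu, hfix⟩ := exists_actSphere_eq x y
  have hp : actSphere u (pole m) = pole m := hfix _ (by
    simp [pole, EuclideanSpace.inner_single_left, h])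
  conv_rhs => rw [← hf u hp, sphRep_apply, actSphere_inv_eq hu]

/-- The functions `x ↦ φ(x₀)` for polynomials `φ` of degree at most `k`. -/
def poleFunctions (m k : ℕ) : Submodule ℂ C(Sph (m + 2), ℂ) :=
  (Polynomial.degreeLT ℂ (k + 1)).map (Polynomial.aeval (coordFun (0 : Fin (m + 2)))).toLinearMap

instance degreeLT_finite (k : ℕ) : Module.Finite ℂ (Polynomial.degreeLT ℂ k) :=
  Module.Finite.equiv (Polynomial.degreeLTEquiv ℂ k).symm

instance (m k : ℕ) : Module.Finite ℂ (poleFunctions m k) := Module.Finite.map _ _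

lemma finrank_poleFunctions_le (m k : ℕ) : Module.finrank ℂ (poleFunctions m k) ≤ k + 1 := by
  refine (Submodule.finrank_map_le _ _).trans ?_
  rw [(Polynomial.degreeLTEquiv ℂ (k + 1)).finrank_eq]
  simp

/-- A homogeneous polynomial restricted to the circle in the first two variables, symmetrized in the
second variable, is a polynomial in the first variable. -/
lemma exists_eval_add_eval_eq {m k : ℕ} {p : MvPolynomial (Fin (m + 2)) ℂ}
    (hp : p.IsHomogeneous k) :
    ∃ A ∈ Polynomial.degreeLT ℂ (k + 1), ∀ s t : ℂ, s ^ 2 + t ^ 2 = 1 →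
      eval (Fin.cons s (Fin.cons t fun _ => 0) : Fin (m + 2) → ℂ) p +
        eval (Fin.cons s (Fin.cons (-t) fun _ => 0) : Fin (m + 2) → ℂ) p = A.eval s := by
  have hd : ∀ d ∈ p.support, ∃ A ∈ Polynomial.degreeLT ℂ (k + 1), ∀ s t : ℂ, s ^ 2 + t ^ 2 = 1 →
      (∏ i, (Fin.cons s (Fin.cons t fun _ => 0) : Fin (m + 2) → ℂ) i ^ d i) +
        (∏ i, (Fin.cons s (Fin.cons (-t) fun _ => 0) : Fin (m + 2) → ℂ) i ^ d i) = A.eval s := by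
    intro d hd
    have hdk : d 0 + d 1 ≤ k := by
      have h := hp (mem_support_iff.1 hd)
      rw [Finsupp.weight_apply, Finsupp.sum_fintype _ _ (by simp), Fin.sum_univ_succ,
        Fin.sum_univ_succ] at h
      simp only [Fin.succ_zero_eq_one, Pi.one_apply, smul_eq_mul, mul_one] at h
      omega
    simp only [Fin.prod_univ_succ, Fin.cons_zero, Fin.cons_succ, Fin.succ_zero_eq_one]
    set c : ℂ := ∏ i : Fin m, 0 ^ d i.succ.succ
    -- Even powers of t become powers of 1 − s²; odd powers cancel between t and −t.
    rcases Nat.even_or_odd' (d 1) with ⟨b, hb | hb⟩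
    · refine ⟨Polynomial.C (2 * c) * (Polynomial.X ^ d 0 * (1 - Polynomial.X ^ 2) ^ b), ?_, ?_⟩
      · rw [Polynomial.mem_degreeLT]
        refine lt_of_le_of_lt Polynomial.degree_le_natDegree ?_
        have : (Polynomial.C (2 * c) * (Polynomial.X ^ d 0 *
            (1 - Polynomial.X ^ 2) ^ b)).natDegree ≤ d 0 + b * 2 := by
          compute_degree
        exact_mod_cast (show _ < k + 1 by omega)
      · intro s t hst
        have ht : t ^ 2 = 1 - s ^ 2 := by linear_combination hst
        simp only [hb, pow_mul, neg_sq, ht, Polynomial.eval_mul, Polynomial.eval_C,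
          Polynomial.eval_pow, Polynomial.eval_X, Polynomial.eval_sub, Polynomial.eval_one]
        ring
    · refine ⟨0, zero_mem _, fun s t _ => ?_⟩
      rw [hb, (Odd.neg_pow ⟨b, rfl⟩ t : (-t) ^ (2 * b + 1) = _), Polynomial.eval_zero]
      ring
  choose! A hA hAe using hd
  refine ⟨∑ d ∈ p.support, coeff d p • A d,
    sum_mem fun d hd => Submodule.smul_mem _ _ (hA d hd), fun s t hst => ?_⟩
  rw [eval_eq', eval_eq', ← Finset.sum_add_distrib, Polynomial.eval_finsetSum]
  refine Finset.sum_congr rfl fun d hd => ?_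
  rw [← mul_add, hAe d hd s t hst, Polynomial.eval_smul, smul_eq_mul]

/-- A zonal function takes at x its value at (x₀, ±√(1 − x₀²), 0, …). Averaging over the two signs
gives a polynomial in x₀. -/
lemma IsZonal.mem_poleFunctions {m k : ℕ} {f : C(Sph (m + 2), ℂ)} (hf : IsZonal f)
    (hk : f ∈ H (m + 2) k) : f ∈ poleFunctions m k := by
  obtain ⟨p, hp, rfl⟩ := hk
  obtain ⟨A, hA, h⟩ := exists_eval_add_eval_eq (mem_Harm.1 hp).1
  refine ⟨(2⁻¹ : ℂ) • A, Submodule.smul_mem _ _ hA, ?_⟩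
  ext x
  have hx : x.1 0 ^ 2 ≤ 1 := by
    have h1 := EuclideanSpace.norm_sq_eq x.1
    rw [norm_eq_of_mem_sphere, Fin.sum_univ_succ] at h1
    have : 0 ≤ ∑ i : Fin (m + 1), ‖x.1 i.succ‖ ^ 2 := Finset.sum_nonneg fun _ _ => sq_nonneg _
    rw [Real.norm_eq_abs, sq_abs] at h1
    linarith
  have key : ∀ t : ℝ, x.1 0 ^ 2 + t ^ 2 = 1 → restrictToSphere (m + 2) p x =
      eval (Fin.cons ((x.1 0 : ℝ) : ℂ) (Fin.cons (t : ℂ) fun _ => 0) : Fin (m + 2) → ℂ) p := by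
    intro t ht
    let y : Sph (m + 2) := ⟨WithLp.toLp 2 (Fin.cons (x.1 0) (Fin.cons t fun _ => 0)), by
      rw [mem_sphere_zero_iff_norm, ← sq_eq_sq₀ (norm_nonneg _) zero_le_one,
        EuclideanSpace.norm_sq_eq, Fin.sum_univ_succ, Fin.sum_univ_succ]
      simpa using ht⟩
    rw [show restrictToSphere (m + 2) p x = _ from hf.apply_eq (y := y) rfl,
      AlgHom.toLinearMap_apply, restrictToSphere_apply]
    congr 2
    ext i
    refine Fin.cases rfl (fun i => Fin.cases rfl (fun i => ?_) i) i
    simp [y]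
  have hsq : x.1 0 ^ 2 + Real.sqrt (1 - x.1 0 ^ 2) ^ 2 = 1 := by
    rw [Real.sq_sqrt (by linarith)]; ring
  have h1 := key _ hsq
  have h2 := key (-Real.sqrt (1 - x.1 0 ^ 2)) (by rw [neg_sq]; exact hsq)
  have h3 := h (x.1 0 : ℝ) (Real.sqrt (1 - x.1 0 ^ 2) : ℝ) (by
    rw [← Complex.ofReal_pow, ← Complex.ofReal_pow, ← Complex.ofReal_add, hsq,
      Complex.ofReal_one])
  rw [Complex.ofReal_neg] at h2
  rw [← h1, ← h2] at h3
  have h4 : (Polynomial.aeval (coordFun (0 : Fin (m + 2))) A) x =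
      A.eval ((x.1 0 : ℝ) : ℂ) := by
    rw [Polynomial.aeval_eq_sum_range, Polynomial.eval_eq_sum_range, ContinuousMap.sum_apply]
    rfl
  rw [map_smul, ContinuousMap.smul_apply, AlgHom.toLinearMap_apply, h4, ← h3]
  simp only [AlgHom.toLinearMap_apply, smul_eq_mul]
  ring

/-- A function representing a functional that is invariant under the stabilizer of the pole is
zonal. -/
lemma isZonal_of_functional {m : ℕ} {W : Submodule ℂ C(Sph (m + 2), ℂ)}
    (hW : ∀ u, ∀ f ∈ W, sphRep (m + 2) u f ∈ W) {l : W →ₗ[ℂ] ℂ}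
    (hl : ∀ u : OGroup (m + 2), actSphere u (pole m) = pole m → ∀ f : W,
      l ⟨sphRep (m + 2) u f, hW u f f.2⟩ = l f)
    {w : C(Sph (m + 2), ℂ)} (hw : w ∈ W) (h : ∀ f : W, l f = sphInner (f : C(Sph (m + 2), ℂ)) w) :
    IsZonal w := by
  intro u hu
  refine eq_of_forall_sphInner_eq (hW u w hw) hw fun f hf => ?_
  have h1 := hl u⁻¹ (actSphere_inv_eq hu) ⟨f, hf⟩
  rw [h, h] at h1
  have h2 : sphInner f (sphRep (m + 2) u w) = sphInner f w := by
    rw [← h1, sphInner_sphRep_left, inv_inv]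
  rw [sphInner_eq_inner, sphInner_eq_inner] at h2 ⊢
  rw [← inner_conj_symm, h2, inner_conj_symm]

/-- Evaluation at the pole, as a linear functional. -/
def evalPole {m : ℕ} (W : Submodule ℂ C(Sph (m + 2), ℂ)) : W →ₗ[ℂ] ℂ where
  toFun f := (f : C(Sph (m + 2), ℂ)) (pole m)
  map_add' _ _ := rfl
  map_smul' _ _ := rfl

/-- The function representing evaluation at the pole is zonal since the functional is invariant
under the stabilizer. Were it zero, all of H_k would vanish at the pole, hence everywhere by
transitivity. -/
lemma exists_zonal {m k : ℕ} : ∃ w ∈ H (m + 2) k, w ≠ 0 ∧ IsZonal w ∧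
    ∀ f ∈ H (m + 2) k, f (pole m) = sphInner f w := by
  obtain ⟨w, hw, h⟩ := exists_eq_sphInner (H (m + 2) k) (evalPole _)
  refine ⟨w, hw, ?_, isZonal_of_functional (fun u f hf => sphRep_mem_H u hf) (l := evalPole _) ?_
    hw h, fun f hf => h ⟨f, hf⟩⟩
  · rintro rfl
    obtain ⟨f, hf, hf0⟩ := (Submodule.ne_bot_iff _).1 (H_ne_bot (show 2 ≤ m + 2 by omega) k)
    refine hf0 (ContinuousMap.ext fun x => ?_)
    obtain ⟨u, hu, -⟩ := exists_actSphere_eq (pole m) x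
    have h1 := h ⟨_, sphRep_mem_H u⁻¹ hf⟩
    rw [sphInner_eq_inner, map_zero, inner_zero_left] at h1
    change sphRep (m + 2) u⁻¹ f (pole m) = 0 at h1
    rwa [sphRep_inv_apply, hu] at h1
  · intro u hu f
    change sphRep (m + 2) u f (pole m) = _
    rw [sphRep_apply, actSphere_inv_eq hu]
    rfl

/-- The vectors v_0, …, v_k are independent in Z and fill its dimension, so g is a combination of
them; independence of the U_j then leaves only the v_k term. -/
lemma exists_smul_eq_of_finrank_le {V : Type*} [AddCommGroup V] [Module ℂ V]
    {U : ℕ → Submodule ℂ V}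
    (hU : ∀ (m : ℕ) (h : ℕ → V), (∀ j, h j ∈ U j) → ∑ j ∈ Finset.range m, h j = 0 →
      ∀ j < m, h j = 0)
    {k : ℕ} {Z : Submodule ℂ V} [Module.Finite ℂ Z] (hZ : Module.finrank ℂ Z ≤ k + 1)
    {v : ℕ → V} (hv : ∀ j, v j ∈ U j) (hv0 : ∀ j, v j ≠ 0) (hvZ : ∀ j ≤ k, v j ∈ Z)
    {g : V} (hg : g ∈ U k) (hgZ : g ∈ Z) : ∃ c : ℂ, g = c • v k := by
  let b : Fin (k + 1) → Z := fun j => ⟨v j, hvZ j (Nat.lt_succ_iff.1 j.2)⟩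
  have hb : LinearIndependent ℂ b := by
    rw [Fintype.linearIndependent_iff]
    intro a ha i
    have h := hU (k + 1) (fun j => if hj : j < k + 1 then a ⟨j, hj⟩ • v j else 0) (fun j => by
        split_ifs
        exacts [Submodule.smul_mem _ _ (hv j), zero_mem _]) (by
        rw [← Fin.sum_univ_eq_sum_range]
        simpa [b, Fin.is_le] using congrArg Subtype.val ha) i i.2
    simpa [i.2, hv0] using h
  have hspan : ⊤ ≤ Submodule.span ℂ (Set.range b) := by
    refine (hb.span_eq_top_of_card_eq_finrank' ?_).ge
    refine le_antisymm hb.fintype_card_le_finrank ?_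
    simpa using hZ
  obtain ⟨c, hc⟩ := (Submodule.mem_span_range_iff_exists_fun ℂ).1
    (hspan (Submodule.mem_top (x := ⟨g, hgZ⟩)))
  refine ⟨c (Fin.last k), ?_⟩
  have hc' : ∑ i, c i • v i = g := by simpa [b] using congrArg Subtype.val hc
  have h := hU (k + 1)
    (fun j => (if hj : j < k + 1 then c ⟨j, hj⟩ • v j else 0) - if j = k then g else 0)
    (fun j => by
      refine sub_mem ?_ ?_
      · split_ifs
        exacts [Submodule.smul_mem _ _ (hv j), zero_mem _]
      · split_ifs with h
        exacts [h ▸ hg, zero_mem _]) (by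
      rw [Finset.sum_sub_distrib, ← Fin.sum_univ_eq_sum_range]
      simp [hc', Fin.is_le]) k (by omega)
  simp only [Nat.lt_succ_self, dite_true, if_true] at h
  exact (sub_eq_zero.1 h).symm

/-- The zonal spherical harmonics of degree `k` form a space of dimension one. -/
lemma IsZonal.exists_smul_eq {m k : ℕ} {w : C(Sph (m + 2), ℂ)} (hw : w ∈ H (m + 2) k)
    (hw0 : w ≠ 0) (hwz : IsZonal w) {f : C(Sph (m + 2), ℂ)} (hf : f ∈ H (m + 2) k)
    (hfz : IsZonal f) : ∃ c : ℂ, f = c • w := by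
  choose v hv hv0 hvz _ using fun j => exists_zonal (m := m) (k := j)
  have hle : ∀ {i j}, i ≤ j → poleFunctions m i ≤ poleFunctions m j := fun hij =>
    Submodule.map_mono (Polynomial.degreeLT_mono (by omega))
  have key : ∀ g ∈ H (m + 2) k, IsZonal g → ∃ c : ℂ, g = c • v k := fun g hg hgz =>
    exists_smul_eq_of_finrank_le (fun _ _ h h0 => eq_zero_of_sum_range_eq_zero (by omega) h h0)
      (finrank_poleFunctions_le m k) hv hv0
      (fun j hj => hle hj ((hvz j).mem_poleFunctions (hv j))) hg (hgz.mem_poleFunctions hg)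
  obtain ⟨a, rfl⟩ := key w hw hwz
  obtain ⟨c, rfl⟩ := key f hf hfz
  have ha : a ≠ 0 := by
    rintro rfl
    exact hw0 (ContinuousMap.ext fun x => zero_mul _)
  exact ⟨c / a, by rw [smul_smul, div_mul_cancel₀ c ha]⟩

/-! ### Equivariant maps are scalars -/

/-- An equivariant linear map from `H n k` to continuous functions is a multiple of the
inclusion. -/
lemma exists_eq_smul_of_equivariant {m k : ℕ} (T : H (m + 2) k →ₗ[ℂ] C(Sph (m + 2), ℂ))
    (hT : ∀ u, ∀ f : H (m + 2) k, T ⟨sphRep (m + 2) u f.1, sphRep_mem_H u f.2⟩ =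
      sphRep (m + 2) u (T f)) :
    ∃ c : ℂ, ∀ f : H (m + 2) k, T f = c • (f : C(Sph (m + 2), ℂ)) := by
  obtain ⟨w, hw, hw0, hwz, hwe⟩ := exists_zonal (m := m) (k := k)
  -- The functional f ↦ (Tf)(pole) is invariant under the stabilizer, so its representing function z
  -- is a multiple of w.
  let l : H (m + 2) k →ₗ[ℂ] ℂ := evalPole ⊤ ∘ₗ T.codRestrict ⊤ fun _ => trivial
  have hl : ∀ f, l f = T f (pole m) := fun _ => rfl
  obtain ⟨z, hz, hze⟩ := exists_eq_sphInner (H (m + 2) k) l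
  have hzz : IsZonal z := isZonal_of_functional (fun u f hf => sphRep_mem_H u hf) (l := l) (by
    intro u hu f
    rw [hl, hl, hT, sphRep_apply, actSphere_inv_eq hu]) hz hze
  obtain ⟨c, rfl⟩ := hwz.exists_smul_eq hw hw0 hz hzz
  have h : ∀ f : H (m + 2) k, T f (pole m) = (starRingEnd ℂ) c * (f : C(Sph (m + 2), ℂ)) (pole m) := by
    intro f
    rw [← hl, hze, hwe f f.2, sphInner_eq_inner, sphInner_eq_inner, map_smul, inner_smul_left]
  refine ⟨(starRingEnd ℂ) c, fun f => ContinuousMap.ext fun x => ?_⟩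
  obtain ⟨u, hu, -⟩ := exists_actSphere_eq (pole m) x
  have h1 := h ⟨_, sphRep_mem_H u⁻¹ f.2⟩
  rw [hT, sphRep_inv_apply, sphRep_inv_apply, hu] at h1
  exact h1

/-- There is no nonzero equivariant map between spherical harmonics of different degrees. -/
lemma equivariant_eq_zero {m k l : ℕ} (hkl : k ≠ l) (T : H (m + 2) k →ₗ[ℂ] C(Sph (m + 2), ℂ))
    (hT : ∀ u, ∀ f : H (m + 2) k, T ⟨sphRep (m + 2) u f.1, sphRep_mem_H u f.2⟩ =
      sphRep (m + 2) u (T f)) (hl : ∀ f, T f ∈ H (m + 2) l) (f : H (m + 2) k) : T f = 0 := by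
  obtain ⟨c, hc⟩ := exists_eq_smul_of_equivariant T hT
  rw [← Submodule.mem_bot ℂ, ← H_inf_H (n := m + 2) (by omega) hkl]
  refine ⟨?_, hl f⟩
  rw [hc f]
  exact Submodule.smul_mem _ _ f.2

/-- Orthogonal projection to H_l, restricted to H_k, is equivariant and therefore zero. -/
lemma sphInner_eq_zero_of_mem_H {m k l : ℕ} (hkl : k ≠ l) {f g : C(Sph (m + 2), ℂ)}
    (hf : f ∈ H (m + 2) k) (hg : g ∈ H (m + 2) l) : sphInner f g = 0 := by
  have h := equivariant_eq_zero hkl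
    ((H (m + 2) l).subtype ∘ₗ proj (H (m + 2) l) ∘ₗ (H (m + 2) k).subtype)
    (fun u f => proj_sphRep _ (fun u f hf => sphRep_mem_H u hf) u f)
    (fun f => (proj (H (m + 2) l) f).2) ⟨f, hf⟩
  rw [← sphInner_proj (H (m + 2) l) f hg]
  change sphInner ((proj (H (m + 2) l) f : H (m + 2) l) : C(Sph (m + 2), ℂ)) g = 0
  rw [show ((proj (H (m + 2) l) f : H (m + 2) l) : C(Sph (m + 2), ℂ)) = 0 from h,
    sphInner_eq_inner, map_zero, inner_zero_right]

/-- An invariant subspace of `H n k` is zero or all of `H n k`. -/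
lemma eq_bot_or_eq_H_of_invariant {m k : ℕ} {W : Submodule ℂ C(Sph (m + 2), ℂ)}
    (hWk : W ≤ H (m + 2) k) (hW : ∀ u, ∀ f ∈ W, sphRep (m + 2) u f ∈ W) :
    W = ⊥ ∨ W = H (m + 2) k := by
  have : FiniteDimensional ℂ W := Submodule.finiteDimensional_of_le hWk
  obtain ⟨c, hc⟩ := exists_eq_smul_of_equivariant (W.subtype ∘ₗ proj W ∘ₗ (H (m + 2) k).subtype)
    fun u f => proj_sphRep W hW u f
  have hc' : ∀ f ∈ H (m + 2) k, (proj W f : C(Sph (m + 2), ℂ)) = c • f := fun f hf => hc ⟨f, hf⟩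
  -- On H_k the projection onto W is the scalar c. It is the identity on W, so c = 0 forces W = 0;
  -- if c ≠ 0, each f in H_k is c⁻¹ times an element of W.
  by_cases h0 : c = 0
  · left
    rw [eq_bot_iff]
    intro f hf
    have h1 : (proj W f : C(Sph (m + 2), ℂ)) = f :=
      eq_of_forall_sphInner_eq (proj W f).2 hf fun g hg => sphInner_proj W f hg
    rw [Submodule.mem_bot, ← h1, hc' f (hWk hf), h0]
    exact zero_smul ℂ f
  · right
    refine le_antisymm hWk fun f hf => ?_
    rw [← inv_smul_smul₀ h0 f, ← hc' f hf]
    exact Submodule.smul_mem _ _ (proj W f).2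

/-! ### Density and expansion in the mean -/

/-- Stone–Weierstrass, in the supremum norm: coordinates separate points, and since they are real,
conjugating coefficients conjugates the function. -/
lemma dense_iSup_H {n : ℕ} (hn : 0 < n) :
    Dense ((⨆ j, H n j : Submodule ℂ C(Sph n, ℂ)) : Set C(Sph n, ℂ)) := by
  let A : StarSubalgebra ℂ C(Sph n, ℂ) :=
    { (restrictToSphere n).range with
      star_mem' := by
        rintro _ ⟨p, rfl⟩
        refine ⟨MvPolynomial.map (starRingEnd ℂ) p, ContinuousMap.ext fun x => ?_⟩
        change restrictToSphere n _ x = star (restrictToSphere n p x)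
        rw [restrictToSphere_apply, restrictToSphere_apply, eval_map, eval₂_eq', eval_eq']
        simp }
  have hA := ContinuousMap.starSubalgebra_topologicalClosure_eq_top_of_separatesPoints A (by
    intro x y hxy
    obtain ⟨i, hi⟩ : ∃ i, x.1 i ≠ y.1 i := by
      by_contra! h
      exact hxy (Subtype.ext (PiLp.ext h))
    refine ⟨_, ⟨restrictToSphere n (X i), ⟨X i, rfl⟩, rfl⟩, ?_⟩
    change restrictToSphere n (X i) x ≠ restrictToSphere n (X i) y
    rw [restrictToSphere_apply, restrictToSphere_apply, eval_X, eval_X]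
    exact fun h => hi (Complex.ofReal_injective h))
  have hd : Dense (A : Set C(Sph n, ℂ)) := fun f => by
    have : f ∈ A.topologicalClosure := hA ▸ trivial
    exact this
  refine hd.mono ?_
  rintro _ ⟨p, rfl⟩
  exact range_restrictToSphere_le hn p

section Expansion

variable {m : ℕ} {h : ℕ → C(Sph (m + 2), ℂ)}

lemma sphInner_sum_of_mem_H (hh : ∀ j, h j ∈ H (m + 2) j) {N k : ℕ} (hk : k < N)
    {g : C(Sph (m + 2), ℂ)} (hg : g ∈ H (m + 2) k) :
    sphInner (∑ j ∈ Finset.range N, h j) g = sphInner (h k) g := by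
  have h1 : ∀ j, inner ℂ (toL2 _ g) (toL2 _ (h j)) = if j = k then sphInner (h k) g else 0 := by
    intro j
    rw [← sphInner_eq_inner]
    split_ifs with hj
    · rw [hj]
    · exact sphInner_eq_zero_of_mem_H hj (hh j) hg
  rw [sphInner_eq_inner, map_sum, inner_sum]
  simp only [h1]
  rw [Finset.sum_ite_eq', if_pos (Finset.mem_range.2 hk)]

lemma sphInner_sub_left (f f' g : C(Sph (m + 2), ℂ)) :
    sphInner (f - f') g = sphInner f g - sphInner f' g := by
  simp only [sphInner_eq_inner, map_sub, inner_sub_right]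

/-- Pairing with g is continuous in the mean, and its value on the partial sums is constant once N >
k. This forces uniqueness of the expansion. -/
lemma sphInner_eq_of_tendsto (hh : ∀ j, h j ∈ H (m + 2) j) {f : C(Sph (m + 2), ℂ)}
    (hf : Tendsto (fun N => meanNorm (f - ∑ k ∈ Finset.range N, h k)) atTop (𝓝 0)) {k : ℕ}
    {g : C(Sph (m + 2), ℂ)} (hg : g ∈ H (m + 2) k) : sphInner (h k) g = sphInner f g := by
  have h1 : Tendsto (fun N => sphInner (f - ∑ k ∈ Finset.range N, h k) g) atTop (𝓝 0) := by
    refine squeeze_zero_norm (fun N => ?_) (by simpa using hf.const_mul ‖toL2 _ g‖)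
    rw [sphInner_eq_inner, meanNorm_eq_norm]
    exact norm_inner_le_norm _ _
  have h2 : Tendsto (fun N => sphInner (f - ∑ k ∈ Finset.range N, h k) g) atTop
      (𝓝 (sphInner f g - sphInner (h k) g)) := by
    refine tendsto_const_nhds.congr' ?_
    filter_upwards [eventually_gt_atTop k] with N hN
    rw [sphInner_sub_left, sphInner_sum_of_mem_H hh hN hg]
  exact (sub_eq_zero.1 (tendsto_nhds_unique h2 h1)).symm

lemma sphInner_eq_zero_of_mem_iSup {f : C(Sph (m + 2), ℂ)} {N : ℕ}
    (hf : ∀ k < N, ∀ g ∈ H (m + 2) k, sphInner f g = 0) {g : C(Sph (m + 2), ℂ)}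
    (hg : g ∈ ⨆ k : Fin N, H (m + 2) k) : sphInner f g = 0 := by
  induction hg using Submodule.iSup_induction' with
  | mem k g hg => exact hf k k.2 g hg
  | zero => rw [sphInner_eq_inner, map_zero, inner_zero_left]
  | add g g' _ _ h h' =>
    rw [sphInner_eq_inner] at *
    rw [map_add, inner_add_left, h, h', add_zero]

lemma meanNorm_le_of_sphInner_eq_zero {f g : C(Sph (m + 2), ℂ)} (h : sphInner f g = 0) :
    meanNorm f ≤ meanNorm (f + g) := by
  rw [sphInner_eq_inner, ← inner_conj_symm, map_eq_zero] at h
  rw [meanNorm_eq_norm, meanNorm_eq_norm, map_add]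
  have h1 := norm_add_sq_eq_norm_sq_add_norm_sq_of_inner_eq_zero (𝕜 := ℂ) _ _ h
  have h2 := mul_self_nonneg ‖toL2 _ g‖
  exact le_of_sq_le_sq (by nlinarith) (norm_nonneg _)

lemma exists_mem_iSup_fin {g : C(Sph (m + 2), ℂ)} (hg : g ∈ ⨆ j, H (m + 2) j) :
    ∃ N₀ : ℕ, ∀ N ≥ N₀, g ∈ ⨆ k : Fin N, H (m + 2) k := by
  induction hg using Submodule.iSup_induction' with
  | mem k g hg => exact ⟨k + 1, fun N hN => Submodule.mem_iSup_of_mem ⟨k, by omega⟩ hg⟩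
  | zero => exact ⟨0, fun _ _ => zero_mem _⟩
  | add g g' _ _ h h' =>
    obtain ⟨a, ha⟩ := h
    obtain ⟨b, hb⟩ := h'
    exact ⟨max a b, fun N hN => add_mem (ha N (le_of_max_le_left hN)) (hb N (le_of_max_le_right hN))⟩

lemma tendsto_meanNorm_sub_sum_proj (f : C(Sph (m + 2), ℂ)) :
    Tendsto (fun N => meanNorm (f - ∑ k ∈ Finset.range N, (proj (H (m + 2) k) f : C(Sph (m + 2), ℂ))))
      atTop (𝓝 0) := by
  rw [Metric.tendsto_atTop]
  intro ε hε
  have hcont : Continuous fun g : C(Sph (m + 2), ℂ) => meanNorm (f - g) := by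
    simp only [meanNorm_eq_norm]
    fun_prop
  -- The mean norm is continuous for the supremum norm, so uniform density supplies an approximant g
  -- in the mean.
  have hopen : IsOpen {g : C(Sph (m + 2), ℂ) | meanNorm (f - g) < ε} :=
    isOpen_lt hcont continuous_const
  obtain ⟨g, hgε, hg⟩ := (dense_iSup_H (n := m + 2) (by omega)).inter_open_nonempty _ hopen
    ⟨f, by simpa [meanNorm_eq_norm] using hε⟩
  obtain ⟨N₀, hN₀⟩ := exists_mem_iSup_fin hg
  refine ⟨N₀, fun N hN => ?_⟩
  set s := ∑ k ∈ Finset.range N, (proj (H (m + 2) k) f : C(Sph (m + 2), ℂ)) with hs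
  have hs_mem : s ∈ ⨆ k : Fin N, H (m + 2) k := sum_mem fun k hk =>
    Submodule.mem_iSup_of_mem (⟨k, Finset.mem_range.1 hk⟩ : Fin N) (proj (H (m + 2) k) f).2
  -- The partial sum s is the best mean approximation to f from H_0 + ⋯ + H_{N−1}, which contains g.
  have horth : sphInner (f - s) (s - g) = 0 := by
    refine sphInner_eq_zero_of_mem_iSup (N := N) (fun k hk v hv => ?_)
      (sub_mem hs_mem (hN₀ N hN))
    rw [sphInner_sub_left, hs, sphInner_sum_of_mem_H (fun k => (proj (H (m + 2) k) f).2) hk hv,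
      sphInner_proj _ _ hv, sub_self]
  have hle := meanNorm_le_of_sphInner_eq_zero horth
  rw [sub_add_sub_cancel] at hle
  rw [Real.dist_eq, sub_zero, abs_of_nonneg (show 0 ≤ meanNorm (f - s) from Real.sqrt_nonneg _)]
  exact hle.trans_lt hgε

lemma isOrthogonalDecomposition_H (m : ℕ) :
    IsOrthogonalDecomposition (fun k => H (m + 2) k) := by
  refine ⟨fun k l hkl f hf g hg => sphInner_eq_zero_of_mem_H hkl hf hg, fun f =>
    ⟨fun k => proj (H (m + 2) k) f, ⟨fun k => (proj _ f).2, tendsto_meanNorm_sub_sum_proj f⟩, ?_⟩⟩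
  rintro h ⟨hh, hlim⟩
  funext k
  refine eq_of_forall_sphInner_eq (hh k) (proj (H (m + 2) k) f).2 fun g hg => ?_
  rw [sphInner_eq_of_tendsto hh hlim hg, sphInner_proj _ _ hg]

end Expansion

/-! ### Irreducibility and inequivalence as representations -/

/-- The spherical harmonics of degree `k` as a subrepresentation of `C(S^{n-1})`. -/
def subrepH (n k : ℕ) : Subrepresentation (sphRep n) where
  toSubmodule := H n k
  apply_mem_toSubmodule u _ hf := sphRep_mem_H u hf

lemma isIrreducibleSub_subrepH (m k : ℕ) : IsIrreducibleSub (subrepH (m + 2) k) := by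
  have hbot : ∀ τ : Subrepresentation (subrepH (m + 2) k).toRepresentation,
      τ.toSubmodule = ⊥ ∨ τ.toSubmodule = ⊤ := by
    intro τ
    let W : Submodule ℂ (H (m + 2) k) := τ.toSubmodule
    -- A subrepresentation of H_k is pushed forward to an invariant subspace of C(S), where the
    -- dichotomy is known.
    have h := eq_bot_or_eq_H_of_invariant (k := k) (W := W.map (H (m + 2) k).subtype)
      (Submodule.map_subtype_le _ _) (by
        rintro u _ ⟨f, hf, rfl⟩
        exact ⟨_, τ.apply_mem_toSubmodule u hf, rfl⟩)
    have hinj := Submodule.map_injective_of_injective (H (m + 2) k).subtype_injective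
    refine h.imp (fun h => hinj (a₁ := W) (a₂ := ⊥) ?_) fun h => hinj (a₁ := W) (a₂ := ⊤) ?_
    · rw [h, Submodule.map_bot]
    · rw [h, Submodule.map_subtype_top]
  have : Nontrivial (H (m + 2) k) :=
    Submodule.nontrivial_iff_ne_bot.2 (H_ne_bot (by omega) k)
  exact
    { exists_pair_ne := ⟨⊥, ⊤, fun h => bot_ne_top (α := Submodule ℂ (H (m + 2) k))
        (congrArg Subrepresentation.toSubmodule h)⟩
      eq_bot_or_eq_top := fun τ => (hbot τ).imp
        (fun h => Subrepresentation.toSubmodule_injective h)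
        (fun h => Subrepresentation.toSubmodule_injective h) }

/-- An equivalence followed by the inclusion of H_l would be a zero map, although H_k is nonzero. -/
lemma not_areEquivalentSub_subrepH {m k l : ℕ} (hkl : k ≠ l) :
    ¬ AreEquivalentSub (subrepH (m + 2) k) (subrepH (m + 2) l) := by
  rintro ⟨e⟩
  obtain ⟨f, hf, hf0⟩ := (Submodule.ne_bot_iff _).1 (H_ne_bot (show 2 ≤ m + 2 by omega) k)
  have h := equivariant_eq_zero hkl ((H (m + 2) l).subtype ∘ₗ e.toLinearEquiv.toLinearMap)
    (fun u f => congrArg Subtype.val (Representation.IntertwiningMap.isIntertwining _ _ e.toIntertwiningMap u f))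
    (fun f => (e.toLinearEquiv f).2) ⟨f, hf⟩
  have h1 : e.toLinearEquiv ⟨f, hf⟩ = 0 := Subtype.ext h
  exact hf0 (congrArg Subtype.val ((LinearEquiv.map_eq_zero_iff _).1 h1))

end SphericalHarmonics

end

theorem mainTheorem5 (n : ℕ) (hn : 2 ≤ n) :
    SphericalHarmonics.IsOrthogonalDecomposition (fun k => SphericalHarmonics.H n k) ∧
    (∃ σ : ℕ → Subrepresentation (SphericalHarmonics.sphRep n),
      (∀ k, (σ k).toSubmodule = SphericalHarmonics.H n k) ∧
      (∀ k, SphericalHarmonics.IsIrreducibleSub (σ k)) ∧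
      (∀ k l, k ≠ l → ¬ SphericalHarmonics.AreEquivalentSub (σ k) (σ l))) ∧
    (∀ k, Module.Finite ℂ (SphericalHarmonics.H n k) ∧
      (Module.finrank ℂ (SphericalHarmonics.H n k) : ℤ) =
        ((n + k - 1).choose (n - 1) : ℤ) - ((n + k - 3).choose (n - 1) : ℤ)) := by
  refine ⟨?_, ⟨SphericalHarmonics.subrepH n, fun _ => rfl, ?_, ?_⟩,
    fun k => ⟨inferInstance, ?_⟩⟩
  · obtain ⟨m, rfl⟩ := Nat.exists_eq_add_of_le' hn
    exact SphericalHarmonics.isOrthogonalDecomposition_H m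
  · obtain ⟨m, rfl⟩ := Nat.exists_eq_add_of_le' hn
    exact SphericalHarmonics.isIrreducibleSub_subrepH m
  · obtain ⟨m, rfl⟩ := Nat.exists_eq_add_of_le' hn
    exact fun k l hkl => SphericalHarmonics.not_areEquivalentSub_subrepH hkl
  · have h := SphericalHarmonics.finrank_H_add hn k
    omega
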